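/- Let $n\ge 1$, let $\Omega\subset\mathbb{R}^n$ be a bounded domain (nonempty, open, connected), $d(x)=\operatorname{dist}(x,\partial\Omega)$, $\tau\in(0,1)$ and $1<p<\infty$. For $0<s<1$ and $f:\Omega\to\mathbb{R}$ in $L^p(\Omega)$ put $$F_s(x)=\int_{|h|<\tau d(x)}\frac{|f(x+h)-f(x)|^p}{|h|^{n+sp}}\,dh\in[0,\infty],\qquad |f|_{\widetilde W^{s,p}(\Omega)}=\Big(\int_\Omega F_s(x)\,dx\Big)^{1/p},$$ and let $\widetilde W^{s,p}(\Omega)$ be the set of $f\in L^p(\Omega)$ such that $\int_\Omega\int_{|x-y|<\tau d(x)}\frac{|f(x)-f(y)|^p}{|x-y|^{n+sp}}\,dy\,dx<\infty$. Let $W^{1,p}(\Omega)$ be the set of $f\in L^p(\Omega)$ whose weak gradient $\nabla f$ exists and lies in $L^p(\Omega)$. For $f\in W^{1,p}(\Omega)$ extend $|\nabla f|$ by zero outside $\Omega$ and set, for $x\in\mathbb{R}^n$, $$|\nabla f|^*(x)=\Big(\int_{\mathbb{S}^{n-1}}\Big(\sup_{t>0}\frac1t\int_0^t|\nabla f|(x+r\nu)\,dr\Big)^p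 d\sigma_\nu\Big)^{1/p}\in[0,\infty],$$ where $\sigma$ is the surface measure on the unit sphere. Then there is a constant $C<\infty$, depending only on $n$, $\Omega$, $\tau$ and $p$ (not on $s$, $f$ or $x$), such that for all $s\in(0,1)$ and all $f\in W^{1,p}(\Omega)$ $$(1-s)\,F_s(x)\le C\,\big(|\nabla f|^*(x)\big)^p$$ for almost every $x\in\Omega$, and for every $x\in\Omega$ if moreover $f\in C^1(\Omega)$. In particular, $$(1-s)\,|f|_{\widetilde W^{s,p}(\Omega)}^p\le C\,\|\nabla f\|_{L^p(\Omega)}^p$$ for all such $s$ and $f$, and hence $W^{1,p}(\Omega)\subset\widetilde W^{s,p}(\Omega)$ for every $s\in(0,1)$. -/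

import Mathlib

open MeasureTheory Set
open scoped ENNReal NNReal ContDiff

noncomputable section

/-- Distance to the boundary, `d(x) = dist(x, ∂Ω)`. -/
def bdryDist {n : ℕ} (Ω : Set (EuclideanSpace ℝ (Fin n))) (x : EuclideanSpace ℝ (Fin n)) : ℝ :=
  Metric.infDist x (frontier Ω)

/-- `g` is the weak (distributional) gradient of `f` on the open set `Ω`: both are locally
integrable on `Ω`, and `∫_Ω f ∂ᵢφ = - ∫_Ω gᵢ φ` for all `φ ∈ C_c^∞(Ω)` and all `i`. -/
def IsWeakGradient {n : ℕ} (Ω : Set (EuclideanSpace ℝ (Fin n)))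
    (f : EuclideanSpace ℝ (Fin n) → ℝ)
    (g : EuclideanSpace ℝ (Fin n) → EuclideanSpace ℝ (Fin n)) : Prop :=
  LocallyIntegrableOn f Ω volume ∧ LocallyIntegrableOn g Ω volume ∧
  ∀ φ : EuclideanSpace ℝ (Fin n) → ℝ,
    ContDiff ℝ ∞ φ → HasCompactSupport φ → tsupport φ ⊆ Ω →
    ∀ i : Fin n,
      ∫ x in Ω, f x * fderiv ℝ φ x (EuclideanSpace.single i 1) = - ∫ x in Ω, g x i * φ x

/-- The Sobolev space `W^{1,p}(Ω)`; only the values of `f` on `Ω` matter. -/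
def sobolevW1 {n : ℕ} (Ω : Set (EuclideanSpace ℝ (Fin n))) (p : ℝ) :
    Set (EuclideanSpace ℝ (Fin n) → ℝ) :=
  {f | MemLp f (ENNReal.ofReal p) (volume.restrict Ω) ∧
    ∃ g : EuclideanSpace ℝ (Fin n) → EuclideanSpace ℝ (Fin n),
      IsWeakGradient Ω f g ∧ MemLp g (ENNReal.ofReal p) (volume.restrict Ω)}

/-- `F_s(x) = ∫_{|h| < τ d(x)} |f(x+h) - f(x)|^p / |h|^{n+sp} dh`, with values in `[0, ∞]`. -/
def restrictedF {n : ℕ} (Ω : Set (EuclideanSpace ℝ (Fin n))) (τ p s : ℝ)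
    (f : EuclideanSpace ℝ (Fin n) → ℝ) (x : EuclideanSpace ℝ (Fin n)) : ℝ≥0∞ :=
  ∫⁻ h in {h : EuclideanSpace ℝ (Fin n) | ‖h‖ < τ * bdryDist Ω x},
    ENNReal.ofReal (|f (x + h) - f x| ^ p / ‖h‖ ^ ((n : ℝ) + s * p))

/-- The seminorm `(∫_Ω F_s(x) dx)^{1/p}`, with values in `[0, ∞]`. -/
def tildeSeminorm {n : ℕ} (Ω : Set (EuclideanSpace ℝ (Fin n))) (τ p s : ℝ)
    (f : EuclideanSpace ℝ (Fin n) → ℝ) : ℝ≥0∞ :=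
  (∫⁻ x in Ω, restrictedF Ω τ p s f x) ^ (1 / p)

/-- The restricted fractional Sobolev space: the functions in `L^p(Ω)` with
`∫_Ω ∫_{|x-y| < τ d(x)} |f(x) - f(y)|^p / |x-y|^{n+sp} dy dx < ∞`. -/
def tildeW {n : ℕ} (Ω : Set (EuclideanSpace ℝ (Fin n))) (τ p s : ℝ) :
    Set (EuclideanSpace ℝ (Fin n) → ℝ) :=
  {f | MemLp f (ENNReal.ofReal p) (volume.restrict Ω) ∧
    ∫⁻ x in Ω, ∫⁻ y in {y : EuclideanSpace ℝ (Fin n) | ‖x - y‖ < τ * bdryDist Ω x},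
      ENNReal.ofReal (|f x - f y| ^ p / ‖x - y‖ ^ ((n : ℝ) + s * p)) < ⊤}

/-- The directional maximal function
`h₁(x, ν) = sup_{t > 0} (1/t) ∫_0^t h(x + ν r) dr` of `h ≥ 0`. -/
def directionalMax {n : ℕ} (h : EuclideanSpace ℝ (Fin n) → ℝ≥0∞)
    (x ν : EuclideanSpace ℝ (Fin n)) : ℝ≥0∞ :=
  ⨆ (t : ℝ) (_ : 0 < t), (ENNReal.ofReal t)⁻¹ * ∫⁻ r in Ioo 0 t, h (x + r • ν)

/-- Calderón's function `h^*(x) = (∫_{S^{n-1}} h₁(x, ν)^p dσ_ν)^{1/p}`, where `σ` is the surface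
measure on the unit sphere. -/
def calderonMax {n : ℕ} (p : ℝ) (h : EuclideanSpace ℝ (Fin n) → ℝ≥0∞)
    (x : EuclideanSpace ℝ (Fin n)) : ℝ≥0∞ :=
  (∫⁻ ν : Metric.sphere (0 : EuclideanSpace ℝ (Fin n)) 1,
    directionalMax h x (ν : EuclideanSpace ℝ (Fin n)) ^ p
      ∂((volume : Measure (EuclideanSpace ℝ (Fin n))).toSphere)) ^ (1 / p)

/-- `|g|` on `Ω`, extended by zero to the whole space. -/
def zeroExtNorm {n : ℕ} (Ω : Set (EuclideanSpace ℝ (Fin n)))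
    (g : EuclideanSpace ℝ (Fin n) → EuclideanSpace ℝ (Fin n)) :
    EuclideanSpace ℝ (Fin n) → ℝ≥0∞ :=
  Ω.indicator fun x => ‖g x‖ₑ

end

/-! Everything rests on the increment bound |f(x+h) - f(x)| ≤ |h| A(x,h) for |h| < d(x), where
A(x,h) is the mean of |∇f| over the segment from x to x+h, a segment that stays in Ω. Inserted in
F_s, it leaves the integral of |h|^((1-s)p-n) A(x,h)^p.

Pointwise bound: in polar coordinates A(x,rν) is at most the directional maximal function at (x,ν),
which does not depend on r. The remaining radial integral is R^((1-s)p)/((1-s)p) with R = τ d(x);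
the factor 1-s cancels, and R ≤ diam Ω makes the constant uniform in s
(`restrictedF_le_calderonMax`).

Integrated bound: no maximal theorem is needed. Jensen moves the power p inside A, and Tonelli with
translation invariance gives ∫ A(x,h)^p dx ≤ ‖∇f‖_p^p for every h (`lintegral_restrictedF_le`).

For Sobolev f the increment bound holds for a.e. x and a.e. h: the weak gradient is tested against
translates φ(· - th) and integrated in t (`ae_sub_eq_integral_segment`). For C¹ functions every x is
allowed: the fundamental theorem of calculus applies on each segment, and almost every segment from
x meets the set where ∇f ≠ g in a null set of parameters (`ae_ae_segment`). -/

/-! ### Geometry of the distance to the boundary -/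

/-- A nearest point of the complement lies on the frontier, so the distance to the frontier cannot
exceed the distance to the complement. -/
theorem ball_bdryDist_subset {n : ℕ} {Ω : Set (EuclideanSpace ℝ (Fin n))}
    {x : EuclideanSpace ℝ (Fin n)} (hx : x ∈ Ω) : Metric.ball x (bdryDist Ω x) ⊆ Ω := by
  by_cases hΩ : Ω = univ
  · simp [hΩ]
  obtain ⟨y, hy, hxy⟩ := exists_mem_frontier_infDist_compl_eq_dist hx hΩ
  refine (Metric.ball_subset_ball ?_).trans (Metric.ball_infDist_compl_subset (x := x))
  rw [hxy]
  exact Metric.infDist_le_dist_of_mem hy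

theorem bdryDist_nonneg {n : ℕ} (Ω : Set (EuclideanSpace ℝ (Fin n)))
    (x : EuclideanSpace ℝ (Fin n)) : 0 ≤ bdryDist Ω x := Metric.infDist_nonneg

theorem continuous_bdryDist {n : ℕ} (Ω : Set (EuclideanSpace ℝ (Fin n))) :
    Continuous (bdryDist Ω) := Metric.continuous_infDist_pt _

theorem bdryDist_le_diam {n : ℕ} {Ω : Set (EuclideanSpace ℝ (Fin n))}
    (hb : Bornology.IsBounded Ω) {x : EuclideanSpace ℝ (Fin n)} (hx : x ∈ Ω) :
    bdryDist Ω x ≤ Metric.diam (closure Ω) := by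
  rcases (frontier Ω).eq_empty_or_nonempty with h | ⟨y, hy⟩
  -- `Metric.infDist` to the empty set is 0 by convention.
  · simp [bdryDist, h, Metric.diam_nonneg]
  · exact (Metric.infDist_le_dist_of_mem hy).trans
      (Metric.dist_le_diam_of_mem hb.closure (subset_closure hx) (frontier_subset_closure hy))

theorem add_smul_mem_of_norm_lt_bdryDist {n : ℕ} {Ω : Set (EuclideanSpace ℝ (Fin n))}
    {x h : EuclideanSpace ℝ (Fin n)} (hx : x ∈ Ω) (hh : ‖h‖ < bdryDist Ω x) {t : ℝ}
    (ht₀ : 0 ≤ t) (ht₁ : t ≤ 1) : x + t • h ∈ Ω := by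
  apply ball_bdryDist_subset hx
  rw [Metric.mem_ball, dist_self_add_left, norm_smul, Real.norm_of_nonneg ht₀]
  exact (mul_le_of_le_one_left (norm_nonneg h) ht₁).trans_lt hh

/-! ### Polar coordinates and radial integrals -/

section Polar

variable {E : Type*} [NormedAddCommGroup E] [NormedSpace ℝ E] [FiniteDimensional ℝ E]
  [MeasurableSpace E] [BorelSpace E] [Nontrivial E] (μ : Measure E) [μ.IsAddHaarMeasure]

/-- Only the inequality is claimed, because this half of Tonelli requires no measurability of `A`;
it will be applied to integrands built from an arbitrary representative of the gradient. -/
theorem lintegral_le_lintegral_sphere (A : E → ℝ≥0∞) :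
    ∫⁻ h, A h ∂μ ≤ ∫⁻ ν : Metric.sphere (0 : E) 1, (∫⁻ r in Ioi (0 : ℝ),
      ENNReal.ofReal (r ^ (Module.finrank ℝ E - 1)) * A (r • (ν : E))) ∂μ.toSphere := by
  have e1 : ∫⁻ h, A h ∂μ = ∫⁻ h : ({0}ᶜ : Set E), A h ∂(μ.comap (↑)) := by
    rw [lintegral_subtype_comap (measurableSet_singleton _).compl, restrict_compl_singleton]
  have e2 := (μ.measurePreserving_homeomorphUnitSphereProd).lintegral_comp_emb
    (Homeomorph.measurableEmbedding _) (fun z ↦ A (z.2.1 • (z.1 : E)))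
  rw [e1]
  calc _ = ∫⁻ h : ({0}ᶜ : Set E), A ((homeomorphUnitSphereProd E h).2.1 •
        ((homeomorphUnitSphereProd E h).1 : E)) ∂(μ.comap (↑)) := by
        refine lintegral_congr fun h ↦ ?_
        congr 1
        exact (congrArg Subtype.val ((homeomorphUnitSphereProd E).symm_apply_apply h)).symm
    _ ≤ _ := by
        rw [e2]
        refine (lintegral_prod_le _).trans (lintegral_mono fun ν ↦ ?_)
        rw [Measure.volumeIoiPow, lintegral_withDensity_eq_lintegral_mul_non_measurable]
        · rw [← lintegral_subtype_comap measurableSet_Ioi]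
          rfl
        · fun_prop
        · simp

end Polar

theorem lintegral_Ioo_rpow {q R : ℝ} (hq : 0 < q) (hR : 0 ≤ R) :
    ∫⁻ r in Ioo 0 R, ENNReal.ofReal (r ^ (q - 1)) = ENNReal.ofReal (R ^ q / q) := by
  have hi : IntervalIntegrable (fun r : ℝ ↦ r ^ (q - 1)) volume 0 R :=
    intervalIntegral.intervalIntegrable_rpow' (by linarith)
  rw [restrict_Ioo_eq_restrict_Ioc, ← ofReal_integral_eq_lintegral_ofReal,
    ← intervalIntegral.integral_of_le hR, integral_rpow (Or.inl (by linarith))]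
  · simp [Real.zero_rpow hq.ne']
  · rwa [intervalIntegrable_iff_integrableOn_Ioc_of_le hR] at hi
  · filter_upwards [ae_restrict_mem measurableSet_Ioc] with r hr
    exact Real.rpow_nonneg hr.1.le _

theorem lintegral_Ioo_comp_mul_left (H : ℝ → ℝ≥0∞) {r : ℝ} (hr : 0 < r) :
    ENNReal.ofReal r * ∫⁻ t in Ioo 0 1, H (r * t) = ∫⁻ t in Ioo 0 r, H t := by
  have he : MeasurableEmbedding fun t : ℝ ↦ r * t :=
    (Homeomorph.mulLeft₀ r hr.ne').measurableEmbedding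
  have hpre : Ioo (0 : ℝ) 1 = (fun t ↦ r * t) ⁻¹' Ioo 0 r := by
    ext t
    simp [hr, div_self hr.ne']
  rw [hpre, ← he.lintegral_map H, ← he.restrict_map, Real.map_volume_mul_left hr.ne', Measure.restrict_smul,
    lintegral_smul_measure, abs_of_pos (inv_pos.2 hr), smul_eq_mul, ← mul_assoc,
    ← ENNReal.ofReal_mul hr.le, mul_inv_cancel₀ hr.ne']
  simp

/-! ### Segment averages -/

/-- The average of `H` over the segment from `x` to `x + h`. -/
noncomputable def segmentAverage {n : ℕ} (H : EuclideanSpace ℝ (Fin n) → ℝ≥0∞)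
    (x h : EuclideanSpace ℝ (Fin n)) : ℝ≥0∞ :=
  ∫⁻ t in Ioo (0 : ℝ) 1, H (x + t • h)

/-- After rescaling, the left side is the member t = r of the supremum. -/
theorem segmentAverage_smul_le_directionalMax {n : ℕ} (H : EuclideanSpace ℝ (Fin n) → ℝ≥0∞)
    (x ν : EuclideanSpace ℝ (Fin n)) {r : ℝ} (hr : 0 < r) :
    segmentAverage H x (r • ν) ≤ directionalMax H x ν := by
  refine le_trans (le_of_eq ?_) (le_iSup₂ (f := fun (t : ℝ) (_ : 0 < t) ↦
    (ENNReal.ofReal t)⁻¹ * ∫⁻ r in Ioo 0 t, H (x + r • ν)) r hr)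
  rw [← lintegral_Ioo_comp_mul_left _ hr, ← mul_assoc,
    ENNReal.inv_mul_cancel (by simpa using hr) ENNReal.ofReal_ne_top, one_mul]
  simp only [segmentAverage, smul_smul, mul_comm]

/-- Jensen on the probability space (0,1), in the form of monotonicity of L^p norms in the exponent.
-/
theorem segmentAverage_rpow_le {n : ℕ} {H : EuclideanSpace ℝ (Fin n) → ℝ≥0∞}
    (hH : Measurable H) (x h : EuclideanSpace ℝ (Fin n)) {p : ℝ} (hp : 1 ≤ p) :
    segmentAverage H x h ^ p ≤ segmentAverage (fun y ↦ H y ^ p) x h := by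
  have : IsProbabilityMeasure (volume.restrict (Ioo (0 : ℝ) 1)) := ⟨by simp⟩
  have hm : AEStronglyMeasurable (fun t : ℝ ↦ H (x + t • h)) (volume.restrict (Ioo (0 : ℝ) 1)) :=
    (hH.comp (by fun_prop)).aestronglyMeasurable
  have hp0 : 0 < p := by linarith
  have := eLpNorm_le_eLpNorm_of_exponent_le (p := 1) (q := ENNReal.ofReal p) (by simpa using hp) hm
  rw [eLpNorm_one_eq_lintegral_enorm, eLpNorm_eq_lintegral_rpow_enorm_toReal (by simpa) (by simp),
    ENNReal.toReal_ofReal hp0.le] at this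
  simpa [segmentAverage, ← ENNReal.rpow_mul, hp0.ne'] using ENNReal.rpow_le_rpow this hp0.le

/-! ### From the increment bound to the pointwise and integrated estimates -/

theorem restrictedF_le_lintegral {n : ℕ} {Ω : Set (EuclideanSpace ℝ (Fin n))} {τ p s : ℝ}
    (hp : 0 < p) {f : EuclideanSpace ℝ (Fin n) → ℝ} {H : EuclideanSpace ℝ (Fin n) → ℝ≥0∞}
    {x : EuclideanSpace ℝ (Fin n)}
    (hf : ∀ᵐ h, ‖h‖ < τ * bdryDist Ω x →
      ENNReal.ofReal |f (x + h) - f x| ≤ ENNReal.ofReal ‖h‖ * segmentAverage H x h) :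
    restrictedF Ω τ p s f x ≤
      ∫⁻ h in {h : EuclideanSpace ℝ (Fin n) | ‖h‖ < τ * bdryDist Ω x},
        ENNReal.ofReal (‖h‖ ^ ((1 - s) * p - n)) * segmentAverage H x h ^ p := by
  have hm : MeasurableSet {h : EuclideanSpace ℝ (Fin n) | ‖h‖ < τ * bdryDist Ω x} :=
    measurableSet_lt measurable_norm measurable_const
  refine lintegral_mono_ae ((ae_restrict_iff' hm).2 (hf.mono fun h hh hR ↦ ?_))
  -- The exponent identity below fails at h = 0, but there the numerator is 0^p = 0.
  rcases eq_or_ne h 0 with rfl | h0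
  · simp [Real.zero_rpow hp.ne']
  have hpos : 0 < ‖h‖ := norm_pos_iff.2 h0
  have hexp : ‖h‖ ^ ((1 - s) * p - n) = ‖h‖ ^ p * (‖h‖ ^ ((n : ℝ) + s * p))⁻¹ := by
    rw [← Real.rpow_neg hpos.le, ← Real.rpow_add hpos]
    ring_nf
  calc ENNReal.ofReal (|f (x + h) - f x| ^ p / ‖h‖ ^ ((n : ℝ) + s * p))
      = ENNReal.ofReal |f (x + h) - f x| ^ p * ENNReal.ofReal (‖h‖ ^ ((n : ℝ) + s * p))⁻¹ := by
        rw [div_eq_mul_inv, ENNReal.ofReal_mul (by positivity),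
          ENNReal.ofReal_rpow_of_nonneg (abs_nonneg _) hp.le]
    _ ≤ (ENNReal.ofReal ‖h‖ * segmentAverage H x h) ^ p *
          ENNReal.ofReal (‖h‖ ^ ((n : ℝ) + s * p))⁻¹ := by
        gcongr
        exact hh hR
    _ = _ := by
        rw [hexp, ENNReal.ofReal_mul (by positivity), ENNReal.mul_rpow_of_nonneg _ _ hp.le,
          ENNReal.ofReal_rpow_of_nonneg hpos.le hp.le]
        ring

/-- The Jacobian r^(n-1) turns the weight r^(q-n) into r^(q-1), integrable at 0 because q > 0. It
serves twice with q = (1-s)p: for the maximal function, and with `B` and `M` equal to 1 for the mass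
of the weight. -/
theorem lintegral_rpow_norm_mul_le {n : ℕ} (hn : 1 ≤ n) {q R : ℝ} (hq : 0 < q) (hR : 0 ≤ R)
    {B M : EuclideanSpace ℝ (Fin n) → ℝ≥0∞}
    (hBM : ∀ ν, ∀ r : ℝ, 0 < r → B (r • ν) ≤ M ν) :
    ∫⁻ h in {h : EuclideanSpace ℝ (Fin n) | ‖h‖ < R}, ENNReal.ofReal (‖h‖ ^ (q - n)) * B h ≤
      ENNReal.ofReal (R ^ q / q) *
        ∫⁻ ν : Metric.sphere (0 : EuclideanSpace ℝ (Fin n)) 1,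
          M ν ∂(volume : Measure (EuclideanSpace ℝ (Fin n))).toSphere := by
  have : Nonempty (Fin n) := ⟨⟨0, hn⟩⟩
  have hm : MeasurableSet {h : EuclideanSpace ℝ (Fin n) | ‖h‖ < R} :=
    measurableSet_lt measurable_norm measurable_const
  rw [← lintegral_indicator hm, ← lintegral_const_mul' _ _ ENNReal.ofReal_ne_top]
  refine (lintegral_le_lintegral_sphere volume _).trans (lintegral_mono fun ν ↦ ?_)
  rw [← lintegral_Ioo_rpow hq hR, ← lintegral_mul_const _ (by fun_prop),
    ← lintegral_indicator measurableSet_Ioo, ← lintegral_indicator measurableSet_Ioi]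
  refine lintegral_mono fun r ↦ ?_
  by_cases hr : 0 < r
  swap
  · simp [hr]
  have hν : ‖r • (ν : EuclideanSpace ℝ (Fin n))‖ = r := by
    simp [norm_smul, abs_of_pos hr]
  by_cases hrR : r < R
  · have hexp : r ^ (q - 1) = r ^ (n - 1) * r ^ (q - n) := by
      rw [← Real.rpow_natCast, ← Real.rpow_add hr, Nat.cast_sub hn]
      push_cast
      ring_nf
    simp only [mem_Ioi, hr, indicator_of_mem, finrank_euclideanSpace, Fintype.card_fin, mem_ofPred_eq,
      hν, hrR, mem_Ioo, and_self]
    rw [hexp, ENNReal.ofReal_mul (by positivity), mul_assoc]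
    gcongr
    exact hBM _ _ hr
  · simp [hr, hν, hrR]

/-- The factor 1-s cancels the blow-up of the radial integral as s → 1. Replacing R by max 1 D makes
the base at least 1, so the exponent (1-s)p can be raised to p, which removes s. -/
theorem ofReal_mul_ofReal_rpow_div_le {s p R D : ℝ} (hs₀ : 0 < s) (hs₁ : s < 1) (hp : 0 < p)
    (hR : 0 ≤ R) (hRD : R ≤ D) :
    ENNReal.ofReal (1 - s) * ENNReal.ofReal (R ^ ((1 - s) * p) / ((1 - s) * p)) ≤
      ENNReal.ofReal (max 1 D ^ p / p) := by
  have h1s : 0 < 1 - s := by linarith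
  rw [← ENNReal.ofReal_mul h1s.le]
  refine ENNReal.ofReal_le_ofReal ?_
  have : (1 - s) * (R ^ ((1 - s) * p) / ((1 - s) * p)) = R ^ ((1 - s) * p) / p := by
    field_simp
  rw [this]
  gcongr
  calc R ^ ((1 - s) * p) ≤ max 1 D ^ ((1 - s) * p) := by
        gcongr
        exact hRD.trans (le_max_right _ _)
    _ ≤ max 1 D ^ p :=
        Real.rpow_le_rpow_of_exponent_le (le_max_left _ _) (by nlinarith)

theorem restrictedF_le_calderonMax {n : ℕ} (hn : 1 ≤ n) {Ω : Set (EuclideanSpace ℝ (Fin n))}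
    (hΩ : Bornology.IsBounded Ω) {τ p s : ℝ} (hτ₀ : 0 < τ) (hτ₁ : τ < 1) (hp : 0 < p)
    (hs₀ : 0 < s) (hs₁ : s < 1) {f : EuclideanSpace ℝ (Fin n) → ℝ}
    {H : EuclideanSpace ℝ (Fin n) → ℝ≥0∞} {x : EuclideanSpace ℝ (Fin n)} (hx : x ∈ Ω)
    (hf : ∀ᵐ h, ‖h‖ < τ * bdryDist Ω x →
      ENNReal.ofReal |f (x + h) - f x| ≤ ENNReal.ofReal ‖h‖ * segmentAverage H x h) :
    ENNReal.ofReal (1 - s) * restrictedF Ω τ p s f x ≤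
      ENNReal.ofReal (max 1 (Metric.diam (closure Ω)) ^ p / p) * calderonMax p H x ^ p := by
  have hd := bdryDist_nonneg Ω x
  have hdD := bdryDist_le_diam hΩ hx
  have key := (restrictedF_le_lintegral (s := s) hp hf).trans
    (lintegral_rpow_norm_mul_le hn (mul_pos (sub_pos.2 hs₁) hp) (mul_nonneg hτ₀.le hd)
      (M := fun ν ↦ directionalMax H x ν ^ p)
      fun ν r hr ↦ ENNReal.rpow_le_rpow (segmentAverage_smul_le_directionalMax H x ν hr) hp.le)
  have hc : calderonMax p H x ^ p = ∫⁻ ν : Metric.sphere (0 : EuclideanSpace ℝ (Fin n)) 1,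
      directionalMax H x ν ^ p ∂(volume : Measure (EuclideanSpace ℝ (Fin n))).toSphere := by
    rw [calderonMax, ← ENNReal.rpow_mul, one_div_mul_cancel hp.ne', ENNReal.rpow_one]
  rw [hc]
  calc _ ≤ ENNReal.ofReal (1 - s) * _ := mul_le_mul_right key _
    _ ≤ _ := by
      rw [← mul_assoc]
      gcongr
      exact ofReal_mul_ofReal_rpow_div_le hs₀ hs₁ hp (by positivity)
        ((mul_le_of_le_one_left hd hτ₁.le).trans hdD)

/-- The h-domain is enlarged to the ball of radius D, independent of x, so that the x-integral can
be done first; by translation invariance it does not depend on h. -/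
theorem lintegral_restrictedF_le {n : ℕ} (hn : 1 ≤ n) {Ω : Set (EuclideanSpace ℝ (Fin n))}
    (hΩm : MeasurableSet Ω)
    (hΩ : Bornology.IsBounded Ω) {τ p s : ℝ} (hτ₁ : τ < 1) (hp : 1 ≤ p)
    (hs₀ : 0 < s) (hs₁ : s < 1) {f : EuclideanSpace ℝ (Fin n) → ℝ}
    {H : EuclideanSpace ℝ (Fin n) → ℝ≥0∞} (hH : Measurable H)
    (hf : ∀ᵐ x, x ∈ Ω → ∀ᵐ h, ‖h‖ < τ * bdryDist Ω x →
      ENNReal.ofReal |f (x + h) - f x| ≤ ENNReal.ofReal ‖h‖ * segmentAverage H x h) :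
    ENNReal.ofReal (1 - s) * ∫⁻ x in Ω, restrictedF Ω τ p s f x ≤
      ENNReal.ofReal (max 1 (Metric.diam (closure Ω)) ^ p / p) *
        (volume : Measure (EuclideanSpace ℝ (Fin n))).toSphere univ * ∫⁻ x, H x ^ p := by
  have hp0 : 0 < p := by linarith
  set D := Metric.diam (closure Ω)
  have hD : 0 ≤ D := Metric.diam_nonneg
  set w : EuclideanSpace ℝ (Fin n) → ℝ≥0∞ := fun h ↦ ENNReal.ofReal (‖h‖ ^ ((1 - s) * p - n))
  have hw : Measurable w := by fun_prop
  have h1 : ∀ᵐ x ∂(volume.restrict Ω), restrictedF Ω τ p s f x ≤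
      ∫⁻ h in {h : EuclideanSpace ℝ (Fin n) | ‖h‖ < D},
        w h * segmentAverage (fun y ↦ H y ^ p) x h := by
    refine (ae_restrict_iff' hΩm).2 (hf.mono fun x hx hxΩ ↦ ?_)
    refine (restrictedF_le_lintegral hp0 (hx hxΩ)).trans ?_
    refine (lintegral_mono_set fun h hh ↦ ?_).trans
      (lintegral_mono fun h ↦ mul_le_mul_right (segmentAverage_rpow_le hH x h hp) _)
    exact (mem_ofPred.1 hh).trans_le ((mul_le_of_le_one_left (bdryDist_nonneg _ _) hτ₁.le).trans
      (bdryDist_le_diam hΩ hxΩ))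
  have hHp : Measurable fun y ↦ H y ^ p := hH.pow_const p
  have h2 : ∀ h : EuclideanSpace ℝ (Fin n),
      ∫⁻ x, segmentAverage (fun y ↦ H y ^ p) x h = ∫⁻ x, H x ^ p := by
    intro h
    simp only [segmentAverage]
    have hm : Measurable fun z : EuclideanSpace ℝ (Fin n) × ℝ ↦ H (z.1 + z.2 • h) ^ p :=
      hHp.comp (by fun_prop)
    rw [lintegral_lintegral_swap hm.aemeasurable]
    simp [lintegral_add_right_eq_self (fun y ↦ H y ^ p)]
  have hseg : Measurable fun z : EuclideanSpace ℝ (Fin n) × EuclideanSpace ℝ (Fin n) ↦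
      segmentAverage (fun y ↦ H y ^ p) z.1 z.2 :=
    Measurable.lintegral_prod_right' (f := fun z :
      (EuclideanSpace ℝ (Fin n) × EuclideanSpace ℝ (Fin n)) × ℝ ↦
        H (z.1.1 + z.2 • z.1.2) ^ p) (hHp.comp (by fun_prop))
  have h3 : ∫⁻ x in Ω, restrictedF Ω τ p s f x ≤
      (∫⁻ h in {h : EuclideanSpace ℝ (Fin n) | ‖h‖ < D}, w h) * ∫⁻ x, H x ^ p := by
    refine (lintegral_mono_ae h1).trans ((setLIntegral_le_lintegral _ _).trans ?_)
    rw [lintegral_lintegral_swap ((hw.comp measurable_snd).mul hseg).aemeasurable,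
      ← lintegral_mul_const _ hw]
    refine lintegral_mono fun h ↦ ?_
    have hm : Measurable fun x ↦ segmentAverage (fun y ↦ H y ^ p) x h :=
      hseg.comp (measurable_id.prodMk measurable_const)
    rw [lintegral_const_mul _ hm, h2]
  have h4 := lintegral_rpow_norm_mul_le hn (mul_pos (sub_pos.2 hs₁) hp0) hD
    (B := fun _ ↦ 1) (M := fun _ ↦ 1) fun _ _ _ ↦ le_rfl
  simp only [mul_one, lintegral_one] at h4
  calc _ ≤ ENNReal.ofReal (1 - s) * _ := mul_le_mul_right (h3.trans (mul_le_mul_left h4 _)) _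
    _ ≤ _ := by
      rw [← mul_assoc, ← mul_assoc]
      gcongr
      exact ofReal_mul_ofReal_rpow_div_le hs₀ hs₁ hp0 hD le_rfl

/-! ### Increments of weakly differentiable functions -/

theorem integral_Ioo_fderiv_sub_smul {E : Type*} [NormedAddCommGroup E] [NormedSpace ℝ E]
    {φ : E → ℝ} (hφ : ContDiff ℝ ∞ φ) (y h : E) :
    ∫ t in Ioo (0 : ℝ) 1, fderiv ℝ φ (y - t • h) h = φ y - φ (y - h) := by
  have hc : Continuous (fderiv ℝ φ) := hφ.continuous_fderiv (by simp)
  have hd : ∀ t ∈ uIcc (0 : ℝ) 1,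
      HasDerivAt (fun t : ℝ ↦ -φ (y - t • h)) (fderiv ℝ φ (y - t • h) h) t := by
    intro t _
    have h1 : HasDerivAt (fun t : ℝ ↦ y - t • h) (-h) t := by
      simpa using ((hasDerivAt_id t).smul_const h).const_sub y
    have h2 := ((hφ.differentiable (by simp)) (y - t • h)).hasFDerivAt.comp_hasDerivAt t h1
    have h3 := h2.neg
    rw [map_neg, neg_neg] at h3
    exact h3
  have hint : IntervalIntegrable (fun t : ℝ ↦ fderiv ℝ φ (y - t • h) h) volume 0 1 := by
    apply Continuous.intervalIntegrable
    fun_prop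
  have := intervalIntegral.integral_eq_sub_of_hasDerivAt hd hint
  rw [restrict_Ioo_eq_restrict_Ioc, ← intervalIntegral.integral_of_le zero_le_one, this]
  simp
  ring

section WeakIncrement

variable {E : Type*} [NormedAddCommGroup E] [NormedSpace ℝ E] [FiniteDimensional ℝ E]
  [MeasurableSpace E] [BorelSpace E]

theorem integrable_comp_add_smul {F : Type*} [NormedAddCommGroup F] {μ : Measure E}
    [μ.IsAddHaarMeasure] {K : E → F} (hK : Integrable K μ)
    (hKm : StronglyMeasurable K) (h : E) (ι : Measure ℝ) [IsFiniteMeasure ι] :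
    Integrable (fun z : E × ℝ ↦ K (z.1 + z.2 • h)) (μ.prod ι) := by
  have hm : Measurable fun z : E × ℝ ↦ z.1 + z.2 • h := by fun_prop
  have hKm' : StronglyMeasurable fun z : E × ℝ ↦ K (z.1 + z.2 • h) := hKm.comp_measurable hm
  rw [integrable_prod_iff' hKm'.aestronglyMeasurable]
  refine ⟨Filter.Eventually.of_forall fun t ↦ hK.comp_add_right (t • h), ?_⟩
  simp only [integral_add_right_eq_self (fun y ↦ ‖K y‖)]
  exact integrable_const _

/-- For each t the translation is moved onto φ. The translate φ(· - th) is an admissible test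
function because segments issuing from `U` stay in `Ω`. Integrating its derivative along h over t
telescopes to φ(x) - φ(x-h), and translating back produces the increment of `F`. -/
theorem integral_mul_integral_segment_eq {μ : Measure E} [μ.IsAddHaarMeasure] {Ω U : Set E}
    {F : E → ℝ} {K : E → ℝ} {h : E}
    (hF : Integrable F μ) (hK : Integrable K μ) (hKm : StronglyMeasurable K)
    (hweak : ∀ φ : E → ℝ, ContDiff ℝ ∞ φ → HasCompactSupport φ → tsupport φ ⊆ Ω →
      ∫ x, F x * fderiv ℝ φ x h ∂μ = -∫ x, K x * φ x ∂μ)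
    (hUΩ : ∀ x ∈ U, ∀ t : ℝ, 0 ≤ t → t ≤ 1 → x + t • h ∈ Ω)
    {φ : E → ℝ} (hφ : ContDiff ℝ ∞ φ) (hφc : HasCompactSupport φ) (hφU : tsupport φ ⊆ U) :
    ∫ x, φ x * (∫ t in Ioo (0 : ℝ) 1, K (x + t • h)) ∂μ = ∫ x, φ x * (F (x + h) - F x) ∂μ := by
  obtain ⟨M, hM⟩ := hφc.exists_bound_of_continuous hφ.continuous
  have hdc : Continuous (fderiv ℝ φ) := hφ.continuous_fderiv (by simp)
  obtain ⟨M', hM'⟩ := (hφc.fderiv ℝ).exists_bound_of_continuous hdc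
  have hswap1 : Integrable (fun z : E × ℝ ↦ φ z.1 * K (z.1 + z.2 • h))
      (μ.prod (volume.restrict (Ioo (0 : ℝ) 1))) := by
    refine (integrable_comp_add_smul hK hKm h _).bdd_mul (c := M) ?_
      (Filter.Eventually.of_forall fun z ↦ hM z.1)
    exact (hφ.continuous.comp continuous_fst).aestronglyMeasurable
  have hswap2 : Integrable (fun z : E × ℝ ↦ F z.1 * fderiv ℝ φ (z.1 - z.2 • h) h)
      (μ.prod (volume.restrict (Ioo (0 : ℝ) 1))) := by
    refine (hF.comp_fst _).mul_bdd (c := M' * ‖h‖) ?_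
      (Filter.Eventually.of_forall fun z ↦ ?_)
    · apply Continuous.aestronglyMeasurable
      fun_prop
    · exact (ContinuousLinearMap.le_opNorm _ _).trans (by gcongr; exact hM' _)
  have hslice : ∀ t ∈ Ioo (0 : ℝ) 1,
      ∫ x, φ x * K (x + t • h) ∂μ = -∫ x, F x * fderiv ℝ φ (x - t • h) h ∂μ := by
    intro t ht
    have e : ∫ x, φ x * K (x + t • h) ∂μ = ∫ x, K x * φ (x - t • h) ∂μ := by
      rw [← integral_sub_right_eq_self (fun x ↦ φ x * K (x + t • h)) (t • h)]
      simp [mul_comm]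
    have hsupp : tsupport (fun x ↦ φ (x - t • h)) ⊆ Ω := by
      intro x hx
      have hx' : x - t • h ∈ tsupport φ := by
        have := tsupport_comp_eq_preimage φ (Homeomorph.subRight (t • h))
        exact this.subset hx
      simpa using hUΩ _ (hφU hx') t ht.1.le ht.2.le
    have := hweak (fun x ↦ φ (x - t • h)) (by fun_prop)
      (hφc.comp_homeomorph (Homeomorph.subRight (t • h))) hsupp
    simp only [fderiv_comp_sub] at this
    rw [e, this, neg_neg]
  have hFφ : Integrable (fun x ↦ F x * φ x) μ :=
    hF.mul_bdd (c := M) hφ.continuous.aestronglyMeasurable (Filter.Eventually.of_forall hM)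
  have hFφh : Integrable (fun x ↦ F x * φ (x - h)) μ :=
    hF.mul_bdd (c := M) (by apply Continuous.aestronglyMeasurable; fun_prop)
      (Filter.Eventually.of_forall fun x ↦ hM _)
  have hFhφ : Integrable (fun x ↦ F (x + h) * φ x) μ :=
    (hF.comp_add_right h).mul_bdd (c := M) hφ.continuous.aestronglyMeasurable
      (Filter.Eventually.of_forall hM)
  calc _ = ∫ x, (∫ t in Ioo (0 : ℝ) 1, φ x * K (x + t • h)) ∂μ := by
        simp only [integral_const_mul]
    _ = ∫ t in Ioo (0 : ℝ) 1, ∫ x, φ x * K (x + t • h) ∂μ := integral_integral_swap hswap1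
    _ = ∫ t in Ioo (0 : ℝ) 1, -∫ x, F x * fderiv ℝ φ (x - t • h) h ∂μ :=
        setIntegral_congr_fun measurableSet_Ioo hslice
    _ = -∫ x, (∫ t in Ioo (0 : ℝ) 1, F x * fderiv ℝ φ (x - t • h) h) ∂μ := by
        rw [integral_neg, ← integral_integral_swap hswap2]
    _ = -∫ x, F x * (φ x - φ (x - h)) ∂μ := by
        simp only [integral_const_mul, integral_Ioo_fderiv_sub_smul hφ]
    _ = ∫ x, F x * φ (x - h) ∂μ - ∫ x, F x * φ x ∂μ := by
        simp only [mul_sub]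
        rw [integral_sub hFφ hFφh, neg_sub]
    _ = ∫ x, F (x + h) * φ x ∂μ - ∫ x, F x * φ x ∂μ := by
        rw [← integral_add_right_eq_self (fun x ↦ F x * φ (x - h)) h]
        simp
    _ = _ := by
        rw [← integral_sub hFhφ hFφ]
        congr with x
        ring

/-- A function with weak directional derivative `K` in direction `h` is, for almost every `x`,
the integral of `K` along the segment from `x` to `x + h`. -/
theorem ae_sub_eq_integral_segment {μ : Measure E} [μ.IsAddHaarMeasure] {Ω U : Set E}
    {F : E → ℝ} {K : E → ℝ} {h : E}
    (hF : Integrable F μ) (hK : Integrable K μ) (hKm : StronglyMeasurable K)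
    (hweak : ∀ φ : E → ℝ, ContDiff ℝ ∞ φ → HasCompactSupport φ → tsupport φ ⊆ Ω →
      ∫ x, F x * fderiv ℝ φ x h ∂μ = -∫ x, K x * φ x ∂μ)
    (hU : IsOpen U) (hUΩ : ∀ x ∈ U, ∀ t : ℝ, 0 ≤ t → t ≤ 1 → x + t • h ∈ Ω) :
    ∀ᵐ x ∂μ, x ∈ U → F (x + h) - F x = ∫ t in Ioo (0 : ℝ) 1, K (x + t • h) := by
  have hseg : Integrable (fun x ↦ ∫ t in Ioo (0 : ℝ) 1, K (x + t • h)) μ :=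
    (integrable_comp_add_smul hK hKm h (volume.restrict (Ioo (0 : ℝ) 1))).integral_prod_left
  have hinc : Integrable (fun x ↦ F (x + h) - F x) μ := (hF.comp_add_right h).sub hF
  have := hU.ae_eq_zero_of_integral_contDiff_smul_eq_zero
    ((hinc.sub hseg).locallyIntegrable.locallyIntegrableOn U) fun φ hφ hφc hφU ↦ by
      obtain ⟨M, hM⟩ := hφc.exists_bound_of_continuous hφ.continuous
      simp only [Pi.sub_apply, smul_eq_mul, mul_sub (φ _) (_ - _)]
      rw [integral_sub, integral_mul_integral_segment_eq hF hK hKm hweak hUΩ hφ hφc hφU, sub_self]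
      · exact hinc.bdd_mul (c := M) hφ.continuous.aestronglyMeasurable
          (Filter.Eventually.of_forall hM)
      · exact hseg.bdd_mul (c := M) hφ.continuous.aestronglyMeasurable
          (Filter.Eventually.of_forall hM)
  exact this.mono fun x hx hxU ↦ sub_eq_zero.1 (hx hxU)

end WeakIncrement

/-! ### Null sets along segments and measurable representatives -/

/-- For fixed t ≠ 0 the map h ↦ x + th pulls null sets back to null sets; Fubini then exchanges t
and h. The point x is arbitrary. -/
theorem ae_ae_segment {n : ℕ} {P : EuclideanSpace ℝ (Fin n) → Prop} (hP : ∀ᵐ y, P y)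
    (x : EuclideanSpace ℝ (Fin n)) :
    ∀ᵐ h : EuclideanSpace ℝ (Fin n), ∀ᵐ t ∂(volume.restrict (Ioo (0 : ℝ) 1)), P (x + t • h) := by
  obtain ⟨N, hN, hNm, hN0⟩ := exists_measurable_superset_of_null hP
  have hmeas : MeasurableSet {z : ℝ × EuclideanSpace ℝ (Fin n) | x + z.1 • z.2 ∉ N} :=
    hNm.compl.preimage (by fun_prop : Measurable fun z : ℝ × EuclideanSpace ℝ (Fin n) ↦
      x + z.1 • z.2)
  have h1 : ∀ᵐ t ∂(volume.restrict (Ioo (0 : ℝ) 1)), ∀ᵐ h : EuclideanSpace ℝ (Fin n),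
      x + t • h ∉ N := by
    filter_upwards [ae_restrict_mem measurableSet_Ioo] with t ht
    rw [ae_iff]
    simp only [not_not]
    have : {a | x + t • a ∈ N} = (fun a : EuclideanSpace ℝ (Fin n) ↦ t • a) ⁻¹'
        ((fun y ↦ x + y) ⁻¹' N) := rfl
    rw [this, Measure.addHaar_preimage_smul _ ht.1.ne', measure_preimage_add, hN0, mul_zero]
  filter_upwards [(Measure.ae_ae_comm hmeas).1 h1] with h hh
  filter_upwards [hh] with t ht
  by_contra hcon
  exact ht (hN hcon)

theorem ae_segmentAverage_congr {n : ℕ} {H H' : EuclideanSpace ℝ (Fin n) → ℝ≥0∞}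
    (hH : H =ᵐ[volume] H') (x : EuclideanSpace ℝ (Fin n)) :
    ∀ᵐ h : EuclideanSpace ℝ (Fin n), segmentAverage H x h = segmentAverage H' x h :=
  (ae_ae_segment hH x).mono fun _ hh ↦ lintegral_congr_ae hh

theorem integral_mul_fderiv_eq_of_coordinates {n : ℕ} {F : EuclideanSpace ℝ (Fin n) → ℝ}
    {G : EuclideanSpace ℝ (Fin n) → EuclideanSpace ℝ (Fin n)} (hF : Integrable F)
    (hG : Integrable G) {φ : EuclideanSpace ℝ (Fin n) → ℝ} (hφ : ContDiff ℝ ∞ φ)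
    (hφc : HasCompactSupport φ)
    (hw : ∀ i, ∫ x, F x * fderiv ℝ φ x (EuclideanSpace.single i 1) = -∫ x, G x i * φ x)
    (v : EuclideanSpace ℝ (Fin n)) :
    ∫ x, F x * fderiv ℝ φ x v = -∫ x, inner ℝ (G x) v * φ x := by
  obtain ⟨M, hM⟩ := hφc.exists_bound_of_continuous hφ.continuous
  have hdc : Continuous (fderiv ℝ φ) := hφ.continuous_fderiv (by simp)
  obtain ⟨M', hM'⟩ := (hφc.fderiv ℝ).exists_bound_of_continuous hdc
  have h1 : ∀ x, F x * fderiv ℝ φ x v =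
      ∑ i, v i * (F x * fderiv ℝ φ x (EuclideanSpace.single i 1)) := by
    intro x
    conv_lhs => rw [← (EuclideanSpace.basisFun (Fin n) ℝ).sum_repr v]
    simp only [map_sum, map_smul, Finset.mul_sum, EuclideanSpace.basisFun_repr,
      EuclideanSpace.basisFun_apply, smul_eq_mul]
    exact Finset.sum_congr rfl fun i _ ↦ by ring
  have h2 : ∀ x, inner ℝ (G x) v * φ x = ∑ i, v i * (G x i * φ x) := by
    intro x
    simp only [PiLp.inner_apply, RCLike.inner_apply, conj_trivial, Finset.sum_mul, mul_assoc]
  simp only [h1, h2]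
  rw [integral_finsetSum, integral_finsetSum, ← Finset.sum_neg_distrib]
  · simp only [integral_const_mul, hw, mul_neg]
  · intro i _
    have hGi : Integrable fun x ↦ G x i := by
      simpa using (EuclideanSpace.proj (𝕜 := ℝ) i).integrable_comp hG
    exact (hGi.mul_bdd (c := M) hφ.continuous.aestronglyMeasurable
      (Filter.Eventually.of_forall hM)).const_mul _
  · intro i _
    refine (hF.mul_bdd (c := M' * ‖EuclideanSpace.single i (1 : ℝ)‖) ?_
      (Filter.Eventually.of_forall fun x ↦ ?_)).const_mul _
    · apply Continuous.aestronglyMeasurable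
      fun_prop
    · exact (ContinuousLinearMap.le_opNorm _ _).trans (by gcongr; exact hM' _)

/-- Fubini in (x,h) needs genuinely measurable functions, and translations need functions on the
whole space; hence measurable versions extended by zero. -/
theorem IsWeakGradient.exists_measurable_representative {n : ℕ}
    {Ω : Set (EuclideanSpace ℝ (Fin n))} (hΩm : MeasurableSet Ω)
    {f : EuclideanSpace ℝ (Fin n) → ℝ} {g : EuclideanSpace ℝ (Fin n) → EuclideanSpace ℝ (Fin n)}
    (hf : IntegrableOn f Ω) (hg : IntegrableOn g Ω) (hw : IsWeakGradient Ω f g) :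
    ∃ (F : EuclideanSpace ℝ (Fin n) → ℝ)
      (G : EuclideanSpace ℝ (Fin n) → EuclideanSpace ℝ (Fin n)),
      StronglyMeasurable F ∧ StronglyMeasurable G ∧ Integrable F ∧ Integrable G ∧
      (∀ᵐ x, x ∈ Ω → F x = f x) ∧ (∀ᵐ x, x ∈ Ω → G x = g x) ∧ (∀ x ∉ Ω, G x = 0) ∧
      ∀ φ : EuclideanSpace ℝ (Fin n) → ℝ, ContDiff ℝ ∞ φ → HasCompactSupport φ →
        tsupport φ ⊆ Ω → ∀ v, ∫ x, F x * fderiv ℝ φ x v = -∫ x, inner ℝ (G x) v * φ x := by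
  set f' := hf.1.mk f
  set g' := hg.1.mk g
  have hff' : f =ᵐ[volume.restrict Ω] f' := hf.1.ae_eq_mk
  have hgg' : g =ᵐ[volume.restrict Ω] g' := hg.1.ae_eq_mk
  have hFi : Integrable (Ω.indicator f') :=
    (integrable_indicator_iff hΩm).2 (hf.congr hff')
  have hGi : Integrable (Ω.indicator g') :=
    (integrable_indicator_iff hΩm).2 (hg.congr hgg')
  refine ⟨Ω.indicator f', Ω.indicator g', hf.1.stronglyMeasurable_mk.indicator hΩm,
    hg.1.stronglyMeasurable_mk.indicator hΩm, hFi, hGi, ?_, ?_,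
    fun x hx ↦ indicator_of_notMem hx _, fun φ hφ hφc hφΩ v ↦ ?_⟩
  · filter_upwards [(ae_restrict_iff' hΩm).1 hff'] with x hx hxΩ
    rw [indicator_of_mem hxΩ, hx hxΩ]
  · filter_upwards [(ae_restrict_iff' hΩm).1 hgg'] with x hx hxΩ
    rw [indicator_of_mem hxΩ, hx hxΩ]
  refine integral_mul_fderiv_eq_of_coordinates hFi hGi hφ hφc (fun i ↦ ?_) v
  have h1 : ∀ x, Ω.indicator f' x * fderiv ℝ φ x (EuclideanSpace.single i 1) =
      Ω.indicator (fun x ↦ f' x * fderiv ℝ φ x (EuclideanSpace.single i 1)) x := by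
    intro x
    by_cases hx : x ∈ Ω <;> simp [hx]
  have h2 : ∀ x, Ω.indicator g' x i * φ x = Ω.indicator (fun x ↦ g' x i * φ x) x := by
    intro x
    by_cases hx : x ∈ Ω <;> simp [hx]
  simp only [h1, h2]
  rw [integral_indicator hΩm, integral_indicator hΩm]
  have h3 : ∫ x in Ω, f' x * fderiv ℝ φ x (EuclideanSpace.single i 1) =
      ∫ x in Ω, f x * fderiv ℝ φ x (EuclideanSpace.single i 1) :=
    integral_congr_ae (hff'.mono fun x hx ↦ by simp only [hx])
  have h4 : ∫ x in Ω, g' x i * φ x = ∫ x in Ω, g x i * φ x :=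
    integral_congr_ae (hgg'.mono fun x hx ↦ by simp only [hx])
  rw [h3, h4]
  exact hw.2.2 φ hφ hφc hφΩ i

theorem ofReal_abs_integral_inner_le {n : ℕ}
    (G : EuclideanSpace ℝ (Fin n) → EuclideanSpace ℝ (Fin n)) (x h : EuclideanSpace ℝ (Fin n)) :
    ENNReal.ofReal |∫ t in Ioo (0 : ℝ) 1, inner ℝ (G (x + t • h)) h| ≤
      ENNReal.ofReal ‖h‖ * segmentAverage (fun y ↦ ‖G y‖ₑ) x h := by
  rw [← Real.enorm_eq_ofReal_abs, ofReal_norm, segmentAverage,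
    ← lintegral_const_mul' _ _ enorm_ne_top]
  refine (enorm_integral_le_lintegral_enorm _).trans (lintegral_mono fun t ↦ ?_)
  rw [mul_comm, ← ofReal_norm, ← ofReal_norm, ← ofReal_norm, ← ENNReal.ofReal_mul (norm_nonneg _)]
  exact ENNReal.ofReal_le_ofReal (norm_inner_le_norm _ _)

theorem ae_ae_increment_le {n : ℕ} {Ω : Set (EuclideanSpace ℝ (Fin n))} (hΩ : IsOpen Ω)
    {F : EuclideanSpace ℝ (Fin n) → ℝ} {G : EuclideanSpace ℝ (Fin n) → EuclideanSpace ℝ (Fin n)}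
    (hFm : StronglyMeasurable F) (hGm : StronglyMeasurable G) (hF : Integrable F)
    (hG : Integrable G)
    (hw : ∀ φ : EuclideanSpace ℝ (Fin n) → ℝ, ContDiff ℝ ∞ φ → HasCompactSupport φ →
        tsupport φ ⊆ Ω → ∀ v, ∫ x, F x * fderiv ℝ φ x v = -∫ x, inner ℝ (G x) v * φ x) :
    ∀ᵐ x, ∀ᵐ h, x ∈ Ω → ‖h‖ < bdryDist Ω x →
      ENNReal.ofReal |F (x + h) - F x| ≤
        ENNReal.ofReal ‖h‖ * segmentAverage (fun y ↦ ‖G y‖ₑ) x h := by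
  have hseg : Measurable fun z : EuclideanSpace ℝ (Fin n) × EuclideanSpace ℝ (Fin n) ↦
      segmentAverage (fun y ↦ ‖G y‖ₑ) z.2 z.1 :=
    Measurable.lintegral_prod_right' (f := fun z :
      (EuclideanSpace ℝ (Fin n) × EuclideanSpace ℝ (Fin n)) × ℝ ↦
        ‖G (z.1.2 + z.2 • z.1.1)‖ₑ) (hGm.measurable.comp (by fun_prop)).enorm
  have hlhs : Measurable fun z : EuclideanSpace ℝ (Fin n) × EuclideanSpace ℝ (Fin n) ↦
      ENNReal.ofReal |F (z.2 + z.1) - F z.2| :=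
    (((hFm.measurable.comp (by fun_prop : Measurable fun
      z : EuclideanSpace ℝ (Fin n) × EuclideanSpace ℝ (Fin n) ↦ z.2 + z.1)).sub
      (hFm.measurable.comp measurable_snd)).abs).ennreal_ofReal
  have hmeas : MeasurableSet {z : EuclideanSpace ℝ (Fin n) × EuclideanSpace ℝ (Fin n) |
      z.2 ∈ Ω → ‖z.1‖ < bdryDist Ω z.2 → ENNReal.ofReal |F (z.2 + z.1) - F z.2| ≤
        ENNReal.ofReal ‖z.1‖ * segmentAverage (fun y ↦ ‖G y‖ₑ) z.2 z.1} := by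
    have m1 : MeasurableSet {z : EuclideanSpace ℝ (Fin n) × EuclideanSpace ℝ (Fin n) |
        z.2 ∈ Ω} := measurable_snd hΩ.measurableSet
    have m2 : MeasurableSet {z : EuclideanSpace ℝ (Fin n) × EuclideanSpace ℝ (Fin n) |
        ‖z.1‖ < bdryDist Ω z.2} :=
      measurableSet_lt (by fun_prop) ((continuous_bdryDist Ω).measurable.comp measurable_snd)
    have m3 := measurableSet_le hlhs
      ((by fun_prop : Measurable fun z : EuclideanSpace ℝ (Fin n) × EuclideanSpace ℝ (Fin n) ↦
        ENNReal.ofReal ‖z.1‖).mul hseg)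
    exact m1.imp (m2.imp m3)
  -- The weak formula has an exceptional null set of x for each h; joint measurability allows the
  -- quantifiers to be exchanged.
  refine (Measure.ae_ae_comm hmeas).1 (Filter.Eventually.of_forall fun h ↦ ?_)
  have hUo : IsOpen {x | x ∈ Ω ∧ ‖h‖ < bdryDist Ω x} :=
    hΩ.inter (isOpen_lt continuous_const (continuous_bdryDist Ω))
  have hK : Integrable fun x ↦ inner ℝ (G x) h := hG.inner_const h
  have hKm : StronglyMeasurable fun x ↦ inner ℝ (G x) h := hGm.inner stronglyMeasurable_const
  filter_upwards [ae_sub_eq_integral_segment hF hK hKm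
    (fun φ hφ hφc hφΩ ↦ hw φ hφ hφc hφΩ h) hUo
    fun x hx t ht₀ ht₁ ↦ add_smul_mem_of_norm_lt_bdryDist hx.1 hx.2 ht₀ ht₁] with x hx hxΩ hhx
  rw [hx ⟨hxΩ, hhx⟩]
  exact ofReal_abs_integral_inner_le G x h

/-! ### Classical and weak gradients of C¹ functions -/

theorem integrable_mul_of_locallyIntegrableOn {n : ℕ} {Ω : Set (EuclideanSpace ℝ (Fin n))}
    {u φ : EuclideanSpace ℝ (Fin n) → ℝ} (hu : LocallyIntegrableOn u Ω) (hφ : Continuous φ)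
    (hφc : HasCompactSupport φ) (hφΩ : tsupport φ ⊆ Ω) : Integrable fun x ↦ u x * φ x := by
  obtain ⟨M, hM⟩ := hφc.exists_bound_of_continuous hφ
  have h1 : IntegrableOn (fun x ↦ u x * φ x) (tsupport φ) :=
    (hu.integrableOn_compact_subset hφΩ hφc.isCompact).mul_bdd (c := M) hφ.aestronglyMeasurable
      (Filter.Eventually.of_forall hM)
  refine (integrableOn_iff_integrable_of_support_subset fun x hx ↦ ?_).1 h1
  exact subset_tsupport φ (right_ne_zero_of_mul hx)

/-- The classical gradient of a `C¹` function is its weak gradient. -/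
theorem IsWeakGradient.ae_fderiv_eq_inner {n : ℕ} {Ω : Set (EuclideanSpace ℝ (Fin n))}
    (hΩ : IsOpen Ω) {f : EuclideanSpace ℝ (Fin n) → ℝ}
    {g : EuclideanSpace ℝ (Fin n) → EuclideanSpace ℝ (Fin n)}
    (hw : IsWeakGradient Ω f g) (hf : ContDiffOn ℝ 1 f Ω) :
    ∀ᵐ x, x ∈ Ω → ∀ v, fderiv ℝ f x v = inner ℝ (g x) v := by
  have hfd : ∀ x ∈ Ω, DifferentiableAt ℝ f x := fun x hx ↦
    (hf.differentiableOn (by simp)).differentiableAt (hΩ.mem_nhds hx)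
  have hdc : ContinuousOn (fderiv ℝ f) Ω := hf.continuousOn_fderiv_of_isOpen hΩ le_rfl
  have key : ∀ i, ∀ᵐ x, x ∈ Ω → fderiv ℝ f x (EuclideanSpace.single i 1) - g x i = 0 := by
    intro i
    have hd : LocallyIntegrableOn (fun x ↦ fderiv ℝ f x (EuclideanSpace.single i 1)) Ω :=
      (hdc.clm_apply continuousOn_const).locallyIntegrableOn hΩ.measurableSet
    have hgi : LocallyIntegrableOn (fun x ↦ g x i) Ω := fun x hx ↦ by
      obtain ⟨U, hU, hUi⟩ := hw.2.1 x hx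
      exact ⟨U, hU, (EuclideanSpace.proj (𝕜 := ℝ) i).integrable_comp hUi⟩
    refine hΩ.ae_eq_zero_of_integral_contDiff_smul_eq_zero (hd.sub hgi) fun φ hφ hφc hφΩ ↦ ?_
    have hi1 := integrable_mul_of_locallyIntegrableOn hd hφ.continuous hφc hφΩ
    have hi2 := integrable_mul_of_locallyIntegrableOn hgi hφ.continuous hφc hφΩ
    have hi3 := integrable_mul_of_locallyIntegrableOn hw.1 hφ.continuous hφc hφΩ
    have hφd : Continuous fun x ↦ fderiv ℝ φ x (EuclideanSpace.single i (1 : ℝ)) :=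
      (hφ.continuous_fderiv (by simp)).clm_apply continuous_const
    have hφdc : HasCompactSupport fun x ↦ fderiv ℝ φ x (EuclideanSpace.single i (1 : ℝ)) :=
      hφc.fderiv_apply ℝ _
    have hφds : tsupport (fun x ↦ fderiv ℝ φ x (EuclideanSpace.single i (1 : ℝ))) ⊆ tsupport φ :=
      tsupport_fderiv_apply_subset ℝ _
    have hi4 := integrable_mul_of_locallyIntegrableOn hw.1 hφd hφdc (hφds.trans hφΩ)
    -- Differentiability of `f` is required only on the support of φ, so its values outside `Ω` do
    -- not matter.
    have hibp := integral_mul_fderiv_eq_neg_fderiv_mul_of_integrable (μ := volume) hi1 hi4 hi3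
      (fun x hx ↦ hfd x (hφΩ hx)) (fun x _ ↦ hφ.differentiable (by simp) x)
    have hwk := hw.2.2 φ hφ hφc hφΩ i
    rw [setIntegral_eq_integral_of_forall_compl_eq_zero,
      setIntegral_eq_integral_of_forall_compl_eq_zero, hibp, neg_inj] at hwk
    · have : ∀ x, φ x • ((fun x ↦ fderiv ℝ f x (EuclideanSpace.single i 1)) - fun x ↦ g x i) x =
          fderiv ℝ f x (EuclideanSpace.single i 1) * φ x - g x i * φ x := fun x ↦ by
        simp only [Pi.sub_apply, smul_eq_mul]
        ring
      simp only [smul_eq_mul, Pi.sub_apply] at this ⊢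
      simp only [this]
      rw [integral_sub hi1 hi2, hwk, sub_self]
    · intro x hx
      rw [image_eq_zero_of_notMem_tsupport fun h ↦ hx (hφΩ h), mul_zero]
    · intro x hx
      have : fderiv ℝ φ x (EuclideanSpace.single i (1 : ℝ)) = 0 :=
        image_eq_zero_of_notMem_tsupport (f := fun x ↦ fderiv ℝ φ x (EuclideanSpace.single i 1))
          fun h ↦ hx (hφΩ (hφds h))
      rw [this, mul_zero]
  filter_upwards [ae_all_iff.2 key] with x hx hxΩ v
  conv_lhs => rw [← (EuclideanSpace.basisFun (Fin n) ℝ).sum_repr v]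
  simp only [map_sum, map_smul, EuclideanSpace.basisFun_repr, EuclideanSpace.basisFun_apply,
    smul_eq_mul, PiLp.inner_apply, RCLike.inner_apply, conj_trivial]
  exact Finset.sum_congr rfl fun i _ ↦ by rw [sub_eq_zero.1 (hx i hxΩ)]

theorem sub_eq_integral_fderiv_segment {E : Type*} [NormedAddCommGroup E] [NormedSpace ℝ E]
    {Ω : Set E} (hΩ : IsOpen Ω) {f : E → ℝ} (hf : ContDiffOn ℝ 1 f Ω) {x h : E}
    (hseg : ∀ t : ℝ, 0 ≤ t → t ≤ 1 → x + t • h ∈ Ω) :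
    f (x + h) - f x = ∫ t in Ioo (0 : ℝ) 1, fderiv ℝ f (x + t • h) h := by
  have hd : ∀ t ∈ uIcc (0 : ℝ) 1,
      HasDerivAt (fun t : ℝ ↦ f (x + t • h)) (fderiv ℝ f (x + t • h) h) t := by
    intro t ht
    rw [uIcc_of_le zero_le_one] at ht
    have h1 : HasDerivAt (fun t : ℝ ↦ x + t • h) h t := by
      simpa using ((hasDerivAt_id t).smul_const h).const_add x
    exact ((hf.differentiableOn (by simp)).differentiableAt
      (hΩ.mem_nhds (hseg t ht.1 ht.2))).hasFDerivAt.comp_hasDerivAt t h1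
  have hint : IntervalIntegrable (fun t : ℝ ↦ fderiv ℝ f (x + t • h) h) volume 0 1 := by
    apply ContinuousOn.intervalIntegrable
    refine ContinuousOn.clm_apply ?_ continuousOn_const
    refine (hf.continuousOn_fderiv_of_isOpen hΩ le_rfl).comp (by fun_prop) fun t ht ↦ ?_
    rw [uIcc_of_le zero_le_one] at ht
    exact hseg t ht.1 ht.2
  rw [restrict_Ioo_eq_restrict_Ioc, ← intervalIntegral.integral_of_le zero_le_one,
    intervalIntegral.integral_eq_sub_of_hasDerivAt hd hint]
  simp

/-! ### Transfer to the given function and conclusion -/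

theorem restrictedF_eq_lintegral_sub {n : ℕ} (Ω : Set (EuclideanSpace ℝ (Fin n))) (τ p s : ℝ)
    (f : EuclideanSpace ℝ (Fin n) → ℝ) (x : EuclideanSpace ℝ (Fin n)) :
    ∫⁻ y in {y : EuclideanSpace ℝ (Fin n) | ‖x - y‖ < τ * bdryDist Ω x},
      ENNReal.ofReal (|f x - f y| ^ p / ‖x - y‖ ^ ((n : ℝ) + s * p)) =
    restrictedF Ω τ p s f x := by
  have hm : ∀ g : EuclideanSpace ℝ (Fin n) → ℝ, Measurable g →
      MeasurableSet {y | g y < τ * bdryDist Ω x} := fun g hg ↦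
    measurableSet_lt hg measurable_const
  rw [restrictedF, ← lintegral_indicator (hm _ (by fun_prop)),
    ← lintegral_indicator (hm _ (by fun_prop)), ← lintegral_add_left_eq_self _ x]
  refine lintegral_congr fun h ↦ ?_
  simp [indicator_apply, abs_sub_comm (f x)]

theorem lintegral_zeroExtNorm_rpow {n : ℕ} {Ω : Set (EuclideanSpace ℝ (Fin n))}
    (hΩ : MeasurableSet Ω) {p : ℝ} (hp : 0 < p)
    (g : EuclideanSpace ℝ (Fin n) → EuclideanSpace ℝ (Fin n)) :
    ∫⁻ x, zeroExtNorm Ω g x ^ p =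
      eLpNorm g (ENNReal.ofReal p) (volume.restrict Ω) ^ p := by
  rw [eLpNorm_eq_lintegral_rpow_enorm_toReal (by simpa) (by simp), ENNReal.toReal_ofReal hp.le,
    ← ENNReal.rpow_mul, one_div_mul_cancel hp.ne', ENNReal.rpow_one, ← lintegral_indicator hΩ]
  refine lintegral_congr fun x ↦ ?_
  by_cases hx : x ∈ Ω <;> simp [zeroExtNorm, hx, hp]

/-- Translation by x preserves null sets, so `F` and `f` also agree at x + h for almost every h with
x + h in `Ω`. -/
theorem ae_ae_increment_le_of_representative {n : ℕ} {Ω : Set (EuclideanSpace ℝ (Fin n))}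
    {f F : EuclideanSpace ℝ (Fin n) → ℝ} {H : EuclideanSpace ℝ (Fin n) → ℝ≥0∞}
    (hfF : ∀ᵐ x, x ∈ Ω → F x = f x)
    (hF : ∀ᵐ x, ∀ᵐ h, x ∈ Ω → ‖h‖ < bdryDist Ω x →
      ENNReal.ofReal |F (x + h) - F x| ≤ ENNReal.ofReal ‖h‖ * segmentAverage H x h) :
    ∀ᵐ x, x ∈ Ω → ∀ᵐ h, ‖h‖ < bdryDist Ω x →
      ENNReal.ofReal |f (x + h) - f x| ≤ ENNReal.ofReal ‖h‖ * segmentAverage H x h := by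
  filter_upwards [hfF, hF] with x hx hFx hxΩ
  have htr : ∀ᵐ h, x + h ∈ Ω → F (x + h) = f (x + h) :=
    (measurePreserving_add_left volume x).quasiMeasurePreserving.ae hfF
  filter_upwards [hFx, htr] with h hh hfh hhx
  have hmem : x + h ∈ Ω := by
    simpa using add_smul_mem_of_norm_lt_bdryDist hxΩ hhx zero_le_one le_rfl
  rw [← hx hxΩ, ← hfh hmem]
  exact hh hxΩ hhx

/-- No x is excluded: `f` is controlled by its classical gradient on every segment, and only the
replacement of that gradient by `g` costs a null set of h. -/
theorem IsWeakGradient.ae_increment_le_of_contDiffOn {n : ℕ}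
    {Ω : Set (EuclideanSpace ℝ (Fin n))} (hΩ : IsOpen Ω) {f : EuclideanSpace ℝ (Fin n) → ℝ}
    {g : EuclideanSpace ℝ (Fin n) → EuclideanSpace ℝ (Fin n)} (hw : IsWeakGradient Ω f g)
    (hf : ContDiffOn ℝ 1 f Ω) {x : EuclideanSpace ℝ (Fin n)} (hx : x ∈ Ω) :
    ∀ᵐ h, ‖h‖ < bdryDist Ω x → ENNReal.ofReal |f (x + h) - f x| ≤
      ENNReal.ofReal ‖h‖ * segmentAverage (zeroExtNorm Ω g) x h := by
  filter_upwards [ae_ae_segment (hw.ae_fderiv_eq_inner hΩ hf) x] with h hh hhx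
  have hseg := fun t ↦ add_smul_mem_of_norm_lt_bdryDist (t := t) hx hhx
  have e : ∫ t in Ioo (0 : ℝ) 1, fderiv ℝ f (x + t • h) h =
      ∫ t in Ioo (0 : ℝ) 1, inner ℝ (g (x + t • h)) h := by
    refine integral_congr_ae ?_
    filter_upwards [hh, ae_restrict_mem measurableSet_Ioo] with t ht htI
    exact ht (hseg t htI.1.le htI.2.le) h
  rw [sub_eq_integral_fderiv_segment hΩ hf hseg, e]
  refine (ofReal_abs_integral_inner_le g x h).trans (le_of_eq ?_)
  congr 1
  refine setLIntegral_congr_fun measurableSet_Ioo fun t ht ↦ ?_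
  simp [zeroExtNorm, hseg t ht.1.le ht.2.le]

theorem sobolev_restricted_bounds {n : ℕ} (hn : 1 ≤ n) {Ω : Set (EuclideanSpace ℝ (Fin n))}
    (hΩo : IsOpen Ω) (hΩb : Bornology.IsBounded Ω) {τ p : ℝ} (hτ₀ : 0 < τ) (hτ₁ : τ < 1)
    (hp : 1 ≤ p) {f : EuclideanSpace ℝ (Fin n) → ℝ}
    {g : EuclideanSpace ℝ (Fin n) → EuclideanSpace ℝ (Fin n)}
    (hf : MemLp f (ENNReal.ofReal p) (volume.restrict Ω)) (hw : IsWeakGradient Ω f g)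
    (hg : MemLp g (ENNReal.ofReal p) (volume.restrict Ω)) {s : ℝ} (hs₀ : 0 < s) (hs₁ : s < 1) :
    (∀ᵐ x ∂(volume.restrict Ω), ENNReal.ofReal (1 - s) * restrictedF Ω τ p s f x ≤
      ENNReal.ofReal (max 1 (Metric.diam (closure Ω)) ^ p / p) *
        calderonMax p (zeroExtNorm Ω g) x ^ p) ∧
    ENNReal.ofReal (1 - s) * ∫⁻ x in Ω, restrictedF Ω τ p s f x ≤
      ENNReal.ofReal (max 1 (Metric.diam (closure Ω)) ^ p / p) *
        (volume : Measure (EuclideanSpace ℝ (Fin n))).toSphere univ *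
        eLpNorm g (ENNReal.ofReal p) (volume.restrict Ω) ^ p := by
  have hp0 : 0 < p := by linarith
  have hΩm := hΩo.measurableSet
  -- Boundedness of `Ω` gives L^p ⊆ L^1, hence globally integrable representatives.
  have : IsFiniteMeasure (volume.restrict Ω) := ⟨by simpa using hΩb.measure_lt_top⟩
  have hp1 : 1 ≤ ENNReal.ofReal p := by simpa using hp
  obtain ⟨F, G, hFm, hGm, hFi, hGi, hFf, hGg, hG0, hFG⟩ :=
    hw.exists_measurable_representative hΩm (hf.integrable hp1) (hg.integrable hp1)
  have hae := ae_ae_increment_le_of_representative hFf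
    (ae_ae_increment_le hΩo hFm hGm hFi hGi hFG)
  have hshrink : ∀ x, τ * bdryDist Ω x ≤ bdryDist Ω x := fun x ↦
    mul_le_of_le_one_left (bdryDist_nonneg Ω x) hτ₁.le
  have hGe : (fun y ↦ ‖G y‖ₑ) =ᵐ[volume] zeroExtNorm Ω g := by
    filter_upwards [hGg] with x hx
    by_cases hxΩ : x ∈ Ω
    · simp [zeroExtNorm, hxΩ, hx hxΩ]
    · simp [zeroExtNorm, hxΩ, hG0 x hxΩ]
  constructor
  · refine (ae_restrict_iff' hΩm).2 (hae.mono fun x hx hxΩ ↦ ?_)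
    refine restrictedF_le_calderonMax hn hΩb hτ₀ hτ₁ hp0 hs₀ hs₁ hxΩ ?_
    filter_upwards [hx hxΩ, ae_segmentAverage_congr hGe x] with h hh hseg hhx
    rw [← hseg]
    exact hh (hhx.trans_le (hshrink x))
  · refine (lintegral_restrictedF_le hn hΩm hΩb hτ₁ hp hs₀ hs₁ hGm.measurable.enorm
      (hae.mono fun x hx hxΩ ↦ (hx hxΩ).mono fun h hh hhx ↦
        hh (hhx.trans_le (hshrink x)))).trans (le_of_eq ?_)
    rw [← lintegral_zeroExtNorm_rpow hΩm hp0]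
    congr 1
    exact lintegral_congr_ae (hGe.mono fun x hx ↦ by simp only [hx])

theorem lemma2 (n : ℕ) (hn : 1 ≤ n) (Ω : Set (EuclideanSpace ℝ (Fin n)))
    (hΩ_open : IsOpen Ω) (hΩ_conn : IsConnected Ω) (hΩ_bdd : Bornology.IsBounded Ω)
    (τ : ℝ) (hτ₀ : 0 < τ) (hτ₁ : τ < 1) (p : ℝ) (hp : 1 < p) :
    (∃ C : ℝ≥0, ∀ s : ℝ, 0 < s → s < 1 →
      ∀ (f : EuclideanSpace ℝ (Fin n) → ℝ)
        (g : EuclideanSpace ℝ (Fin n) → EuclideanSpace ℝ (Fin n)),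
        MemLp f (ENNReal.ofReal p) (volume.restrict Ω) →
        IsWeakGradient Ω f g →
        MemLp g (ENNReal.ofReal p) (volume.restrict Ω) →
        (∀ᵐ x ∂(volume.restrict Ω),
          ENNReal.ofReal (1 - s) * restrictedF Ω τ p s f x
            ≤ (C : ℝ≥0∞) * calderonMax p (zeroExtNorm Ω g) x ^ p) ∧
        (ContDiffOn ℝ 1 f Ω → ∀ x ∈ Ω,
          ENNReal.ofReal (1 - s) * restrictedF Ω τ p s f x
            ≤ (C : ℝ≥0∞) * calderonMax p (zeroExtNorm Ω g) x ^ p) ∧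
        ENNReal.ofReal (1 - s) * tildeSeminorm Ω τ p s f ^ p
          ≤ (C : ℝ≥0∞) * eLpNorm g (ENNReal.ofReal p) (volume.restrict Ω) ^ p) ∧
    (∀ s : ℝ, 0 < s → s < 1 → sobolevW1 Ω p ⊆ tildeW Ω τ p s) := by
  have hp0 : 0 < p := by linarith
  set C₁ := ENNReal.ofReal (max 1 (Metric.diam (closure Ω)) ^ p / p)
  set σ := (volume : Measure (EuclideanSpace ℝ (Fin n))).toSphere univ
  have hC₁ : C₁ ≠ ⊤ := ENNReal.ofReal_ne_top
  have hC₂ : C₁ * σ ≠ ⊤ := ENNReal.mul_ne_top hC₁ (measure_ne_top _ _)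
  -- One constant for all three bounds: `C₁` suffices pointwise, `C₁ * σ` for the integral.
  refine ⟨⟨(C₁ + C₁ * σ).toNNReal, fun s hs₀ hs₁ f g hf hw hg ↦ ?_⟩, ?_⟩
  · rw [ENNReal.coe_toNNReal (ENNReal.add_ne_top.2 ⟨hC₁, hC₂⟩)]
    obtain ⟨hpt, hint⟩ :=
      sobolev_restricted_bounds hn hΩ_open hΩ_bdd hτ₀ hτ₁ hp.le hf hw hg hs₀ hs₁
    refine ⟨hpt.mono fun x hx ↦ hx.trans (mul_le_mul_left le_self_add _), fun hf1 x hx ↦ ?_, ?_⟩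
    · refine le_trans ?_ (mul_le_mul_left (le_self_add : C₁ ≤ C₁ + C₁ * σ) _)
      refine restrictedF_le_calderonMax hn hΩ_bdd hτ₀ hτ₁ hp0 hs₀ hs₁ hx ?_
      filter_upwards [hw.ae_increment_le_of_contDiffOn hΩ_open hf1 hx] with h hh hhx
      exact hh (hhx.trans_le (mul_le_of_le_one_left (bdryDist_nonneg Ω x) hτ₁.le))
    · rw [tildeSeminorm, ← ENNReal.rpow_mul, one_div_mul_cancel hp0.ne', ENNReal.rpow_one]
      exact hint.trans (mul_le_mul_left le_add_self _)
  · rintro s hs₀ hs₁ f ⟨hf, g, hw, hg⟩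
    refine ⟨hf, ?_⟩
    simp only [restrictedF_eq_lintegral_sub]
    have hint :=
      (sobolev_restricted_bounds hn hΩ_open hΩ_bdd hτ₀ hτ₁ hp.le hf hw hg hs₀ hs₁).2
    have hfin := hint.trans_lt (ENNReal.mul_lt_top hC₂.lt_top
      (ENNReal.rpow_lt_top_of_nonneg hp0.le hg.2.ne))
    -- Since 1-s is nonzero, finiteness of the product forces finiteness of the integral.
    exact ENNReal.lt_top_of_mul_ne_top_right hfin.ne (by simpa using hs₁)
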